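/- A one-way measure-many quantum finite automaton (1qfa) over a finite alphabet $A$ is a tuple $M=(Q,A,\{U_\sigma\}_{\sigma\in A\cup\{\triangleright,\triangleleft\}},q_0,Q_{acc},Q_{rej})$, where $\triangleright,\triangleleft\notin A$ are the left and right endmarkers, $Q$ is a finite set, $q_0\in Q$, $Q_{acc},Q_{rej}\subseteq Q$ are disjoint, and each $U_\sigma$ is a unitary operator on the Hilbert space $E_Q$ with orthonormal basis $\{|q\rangle : q\in Q\}$. Let $P_{acc},P_{rej},P_{non}$ be the orthogonal projections onto the spans of the $|q\rangle$ with $q\in Q_{acc}$, $q\in Q_{rej}$, $q\in Q\setminus(Q_{acc}\cup Q_{rej})$, respectively. On input $x\in A^n$ with tape content $\triangleright x\triangleleft=\sigma_1\cdots\sigma_{n+2}$, put $|\phi_0\rangle=|q_0\rangle$ and $|\phi_i\rangle=P_{non}U_{\sigma_i}|\phi_{i-1}\rangle$; then $M$ accepts $x$ with probability $p_{acc}(x)=\sum_{i=1}^{n+2}\|P_{acc}U_{\sigma_i}|\phi_{i-1}\rangle\|^2$ and rejects $x$ with probability $p_{rej}(x)=\sum_{i=1}^{n+2}\|P_{rej}U_{\sigma_i}|\phi_{i-1}\rangle\|^2$.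 For alphabets (finite nonempty sets) $\Sigma,\Gamma$ and $x\in\Sigma^n$, $y\in\Gamma^n$, let $[x,y]\in(\Sigma\times\Gamma)^n$ be the string whose $i$-th symbol is $(x_i,y_i)$. A language $L$ over an alphabet $\Sigma$ belongs to $\mathrm{1QFA}/n$ (deterministic advice) if there exist an alphabet $\Gamma$, a 1qfa $M$ over $\Sigma\times\Gamma$, a constant $\varepsilon\in[0,1/2)$ and an arbitrary (not necessarily computable) function $h:\mathbb N\to\Gamma^*$ with $|h(n)|=n$ for all $n$, such that for every $x\in\Sigma^*$: $p_{acc}([x,h(|x|)])\ge 1-\varepsilon$ if $x\in L$, and $p_{rej}([x,h(|x|)])\ge 1-\varepsilon$ if $x\notin L$. It belongs to $\mathrm{1QFA}/Rn$ (randomized advice) if there exist an alphabet $\Gamma$, a 1qfa $M$ over $\Sigma\times\Gamma$, a constant $\varepsilon\in[0,1/2)$ and probability distributions $D_n$ on $\Gamma^n$ $(n\in\mathbb N)$ such that for every $n$ and every $x\in\Sigma^n$: $\sum_{y\in\Gamma^n}D_n(y)\,p_{acc}([x,y])\ge 1-\varepsilon$ if $x\in L$, and $\sum_{y\in\Gamma^n}D_n(y)\,p_{rej}([x,y])\ge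 1-\varepsilon$ if $x\notin L$. **Corollary.** Randomized advice is strictly stronger than deterministic advice for bounded-error 1qfa's: $\mathrm{1QFA}/n\subseteq\mathrm{1QFA}/Rn$ and $\mathrm{1QFA}/n\neq\mathrm{1QFA}/Rn$. -/

import Mathlib

namespace AdvisedQFA

/-- A language together with the alphabet (a finite nonempty set) that it is a language over. -/
structure LanguageOverAlphabet : Type 1 where
  /-- the alphabet `Σ` -/
  Alphabet : Type
  /-- alphabets are finite -/
  finite : Finite Alphabet
  /-- alphabets are nonempty -/
  nonempty : Nonempty Alphabet
  /-- the language, a subset of `Σ^*` -/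
  language : Language Alphabet

/-- The tape symbols `Σ ∪ {¢, $}`. -/
inductive TapeSymbol (A : Type) : Type
  | leftEnd : TapeSymbol A
  | sym (a : A) : TapeSymbol A
  | rightEnd : TapeSymbol A

/-- The tape content `¢ x $`. -/
def tape {A : Type} (x : List A) : List (TapeSymbol A) :=
  TapeSymbol.leftEnd :: (x.map TapeSymbol.sym ++ [TapeSymbol.rightEnd])

/-- A one-way measure-many quantum finite automaton over the input alphabet `A`. -/
structure OneWayQFA (A : Type) : Type 1 where
  /-- the set of inner states -/
  Q : Type
  /-- there are finitely many inner states -/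
  fintypeQ : Fintype Q
  /-- equality of inner states is decidable -/
  decEqQ : DecidableEq Q
  /-- the time-evolution operators: unitary operators on the Hilbert space spanned by `Q` -/
  U : TapeSymbol A → (EuclideanSpace ℂ Q ≃ₗᵢ[ℂ] EuclideanSpace ℂ Q)
  /-- the initial state -/
  q₀ : Q
  /-- the accepting states -/
  Qacc : Finset Q
  /-- the rejecting states -/
  Qrej : Finset Q
  /-- no state is both accepting and rejecting -/
  disjoint_acc_rej : Disjoint Qacc Qrej

attribute [instance] OneWayQFA.fintypeQ OneWayQFA.decEqQ

namespace OneWayQFA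

variable {A : Type}

/-- The non-halting states. -/
def Qnon (M : OneWayQFA A) : Finset M.Q := (M.Qacc ∪ M.Qrej)ᶜ

/-- The orthogonal projection onto the span of the basis vectors `|q⟩` with `q ∈ S`. -/
noncomputable def proj (M : OneWayQFA A) (S : Finset M.Q) :
    EuclideanSpace ℂ M.Q →ₗ[ℂ] EuclideanSpace ℂ M.Q where
  toFun φ := WithLp.toLp 2 fun q => if q ∈ S then φ q else 0
  map_add' φ ψ := by
    ext q
    by_cases h : q ∈ S <;> simp [h]
  map_smul' c φ := by
    ext q
    by_cases h : q ∈ S <;> simp [h]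

/-- One step on an element `(|φ⟩, γ₁, γ₂)`: apply the unitary operator, measure, add the
probabilities of halting in an accepting (resp. rejecting) state to `γ₁` (resp. `γ₂`), and keep
the unnormalized non-halting part of the state. -/
noncomputable def step (M : OneWayQFA A) (ψ : EuclideanSpace ℂ M.Q × ℝ × ℝ)
    (σ : TapeSymbol A) : EuclideanSpace ℂ M.Q × ℝ × ℝ :=
  (M.proj M.Qnon (M.U σ ψ.1),
    ψ.2.1 + ‖M.proj M.Qacc (M.U σ ψ.1)‖ ^ 2,
    ψ.2.2 + ‖M.proj M.Qrej (M.U σ ψ.1)‖ ^ 2)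

/-- The element `(|φ_{n+2}⟩, p_acc(x), p_rej(x))` produced on the tape content `¢ x $` from
`(|q₀⟩, 0, 0)`. -/
noncomputable def run (M : OneWayQFA A) (x : List A) : EuclideanSpace ℂ M.Q × ℝ × ℝ :=
  (tape x).foldl M.step (EuclideanSpace.single M.q₀ 1, 0, 0)

/-- The probability that `M` accepts `x`. -/
noncomputable def pacc (M : OneWayQFA A) (x : List A) : ℝ := (M.run x).2.1

/-- The probability that `M` rejects `x`. -/
noncomputable def prej (M : OneWayQFA A) (x : List A) : ℝ := (M.run x).2.2

end OneWayQFA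

/-- The two-track string with upper track `x` and lower track `y` (strings of equal length). -/
def track {A Γ : Type} (x : List A) (y : List Γ) : List (A × Γ) := List.zip x y

/-- The family `1QFA/n`: bounded-error 1qfa's with deterministic advice of input length. -/
def OneQFA_n : Set LanguageOverAlphabet :=
  {L | ∃ (Γ : Type) (_ : Finite Γ) (_ : Nonempty Γ) (M : OneWayQFA (L.Alphabet × Γ))
      (ε : ℝ) (h : ℕ → List Γ),
      0 ≤ ε ∧ ε < 1 / 2 ∧ (∀ n, (h n).length = n) ∧
      ∀ x : List L.Alphabet,
        (x ∈ L.language → 1 - ε ≤ M.pacc (track x (h x.length))) ∧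
        (x ∉ L.language → 1 - ε ≤ M.prej (track x (h x.length)))}

/-- An advice probability ensemble: for each `n` a probability distribution on `Γ^n`. -/
structure AdviceEnsemble (Γ : Type) [Fintype Γ] where
  /-- the probability `D_n(y)` -/
  D : ∀ n : ℕ, (Fin n → Γ) → ℝ
  /-- probabilities are nonnegative -/
  nonneg : ∀ n y, 0 ≤ D n y
  /-- the total mass is one -/
  sum_eq_one : ∀ n, ∑ y, D n y = 1

/-- The probability that `M` accepts `x` when the advice is drawn from the ensemble. -/
noncomputable def paccR {A Γ : Type} [Fintype Γ] (M : OneWayQFA (A × Γ)) (E : AdviceEnsemble Γ)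
    (x : List A) : ℝ :=
  ∑ y : Fin x.length → Γ, E.D x.length y * M.pacc (track x (List.ofFn y))

/-- The probability that `M` rejects `x` when the advice is drawn from the ensemble. -/
noncomputable def prejR {A Γ : Type} [Fintype Γ] (M : OneWayQFA (A × Γ)) (E : AdviceEnsemble Γ)
    (x : List A) : ℝ :=
  ∑ y : Fin x.length → Γ, E.D x.length y * M.prej (track x (List.ofFn y))

/-- The family `1QFA/Rn`: bounded-error 1qfa's with randomized advice of input length. -/
def OneQFA_Rn : Set LanguageOverAlphabet :=
  {L | ∃ (Γ : Type) (_ : Fintype Γ) (_ : Nonempty Γ) (M : OneWayQFA (L.Alphabet × Γ))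
      (ε : ℝ) (E : AdviceEnsemble Γ),
      0 ≤ ε ∧ ε < 1 / 2 ∧
      ∀ x : List L.Alphabet,
        (x ∈ L.language → 1 - ε ≤ paccR M E x) ∧
        (x ∉ L.language → 1 - ε ≤ prejR M E x)}

end AdvisedQFA

/-! Inclusion: deterministic advice is a point mass. The separating language is the palindromes over
`ZMod 3`. With advice `y = r - r ∘ rev`, `r` uniform, the inner product of `x` and `y` equals `∑ (x
i - x (rev i)) * r i`: identically zero for a palindrome, nonzero with probability 2/3 otherwise. A
reversible automaton computes it, so the error is 1/3 (`palindromes_mem_OneQFA_Rn`). Over `ZMod 2`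
the probability would only be 1/2. With deterministic advice, the configurations reached after half
of the input lie in a compact ball that does not depend on the length. Among exponentially many
half-words two give nearby configurations, and reading the same second half keeps the acceptance
probabilities close (`foldl_step_acc_sub_le`), although one completed word is a palindrome and the
other is not (`palindromes_notMem_OneQFA_n`). -/

namespace AdvisedQFA

/-! ### Conservation of probability and continuity in the configuration -/

namespace OneWayQFA

variable {A : Type}

/-- The accumulated squared norm of the components in `S`, when `l` is read from state `φ`. -/
noncomputable def haltProb (M : OneWayQFA A) (S : Finset M.Q) :
    List (TapeSymbol A) → EuclideanSpace ℂ M.Q → ℝ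
  | [], _ => 0
  | σ :: l, φ => ‖M.proj S (M.U σ φ)‖ ^ 2 + haltProb M S l (M.proj M.Qnon (M.U σ φ))

lemma foldl_step_acc (M : OneWayQFA A) (l : List (TapeSymbol A))
    (ψ : EuclideanSpace ℂ M.Q × ℝ × ℝ) :
    (l.foldl M.step ψ).2.1 = ψ.2.1 + M.haltProb M.Qacc l ψ.1 := by
  induction l generalizing ψ with
  | nil => simp [haltProb]
  | cons σ l ih => simp only [List.foldl_cons, ih, haltProb, step]; ring

lemma foldl_step_rej (M : OneWayQFA A) (l : List (TapeSymbol A))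
    (ψ : EuclideanSpace ℂ M.Q × ℝ × ℝ) :
    (l.foldl M.step ψ).2.2 = ψ.2.2 + M.haltProb M.Qrej l ψ.1 := by
  induction l generalizing ψ with
  | nil => simp [haltProb]
  | cons σ l ih => simp only [List.foldl_cons, ih, haltProb, step]; ring

lemma haltProb_nonneg (M : OneWayQFA A) (S : Finset M.Q) (l : List (TapeSymbol A))
    (φ : EuclideanSpace ℂ M.Q) : 0 ≤ M.haltProb S l φ := by
  induction l generalizing φ with
  | nil => simp [haltProb]
  | cons σ l ih => exact add_nonneg (sq_nonneg _) (ih _)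

lemma norm_sq_proj (M : OneWayQFA A) (S : Finset M.Q) (φ : EuclideanSpace ℂ M.Q) :
    ‖M.proj S φ‖ ^ 2 = ∑ q, if q ∈ S then ‖φ q‖ ^ 2 else 0 := by
  rw [EuclideanSpace.norm_sq_eq]
  refine Finset.sum_congr rfl fun q _ => ?_
  by_cases h : q ∈ S <;> simp [proj, h]

lemma norm_sq_proj_add (M : OneWayQFA A) (φ : EuclideanSpace ℂ M.Q) :
    ‖M.proj M.Qacc φ‖ ^ 2 + ‖M.proj M.Qrej φ‖ ^ 2 + ‖M.proj M.Qnon φ‖ ^ 2 = ‖φ‖ ^ 2 := by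
  rw [norm_sq_proj, norm_sq_proj, norm_sq_proj, EuclideanSpace.norm_sq_eq,
    ← Finset.sum_add_distrib, ← Finset.sum_add_distrib]
  refine Finset.sum_congr rfl fun q _ => ?_
  have hd : q ∈ M.Qacc → q ∉ M.Qrej := fun ha => Finset.disjoint_left.mp M.disjoint_acc_rej ha
  by_cases ha : q ∈ M.Qacc
  · simp [Qnon, ha, hd ha]
  · by_cases hr : q ∈ M.Qrej <;> simp [Qnon, ha, hr]

/-- Unitarity and Pythagoras: each step only moves squared norm into the two accumulators. -/
lemma foldl_step_conserve (M : OneWayQFA A) (l : List (TapeSymbol A))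
    (ψ : EuclideanSpace ℂ M.Q × ℝ × ℝ) :
    ‖(l.foldl M.step ψ).1‖ ^ 2 + (l.foldl M.step ψ).2.1 + (l.foldl M.step ψ).2.2
      = ‖ψ.1‖ ^ 2 + ψ.2.1 + ψ.2.2 := by
  induction l generalizing ψ with
  | nil => rfl
  | cons σ l ih =>
    rw [List.foldl_cons, ih]
    have h := M.norm_sq_proj_add (M.U σ ψ.1)
    rw [LinearIsometryEquiv.norm_map] at h
    simp only [step]
    linarith

lemma haltProb_acc_le (M : OneWayQFA A) (l : List (TapeSymbol A)) (φ : EuclideanSpace ℂ M.Q) :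
    M.haltProb M.Qacc l φ ≤ ‖φ‖ ^ 2 := by
  have h := M.foldl_step_conserve l (φ, 0, 0)
  rw [foldl_step_acc, foldl_step_rej] at h
  have h1 := M.haltProb_nonneg M.Qrej l φ
  simp only at h
  nlinarith [sq_nonneg ‖(l.foldl M.step (φ, 0, 0)).1‖]

lemma pacc_add_prej_le_one (M : OneWayQFA A) (x : List A) : M.pacc x + M.prej x ≤ 1 := by
  have h := M.foldl_step_conserve (tape x) (EuclideanSpace.single M.q₀ 1, 0, 0)
  simp only [PiLp.norm_single, norm_one, one_pow, add_zero] at h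
  simp only [pacc, prej, run]
  nlinarith [sq_nonneg ‖((tape x).foldl M.step (EuclideanSpace.single M.q₀ 1, 0, 0)).1‖]

lemma abs_norm_sq_sub_le {E : Type*} [SeminormedAddCommGroup E] (a b : E) {t : ℝ} (ht : 0 < t) :
    |‖a‖ ^ 2 - ‖b‖ ^ 2| ≤ t * (‖a‖ ^ 2 + ‖b‖ ^ 2) + ‖a - b‖ ^ 2 / (2 * t) := by
  have h1 : |‖a‖ ^ 2 - ‖b‖ ^ 2| ≤ (‖a‖ + ‖b‖) * ‖a - b‖ := by
    rw [sq_sub_sq, abs_mul, abs_of_nonneg (by positivity : 0 ≤ ‖a‖ + ‖b‖)]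
    exact mul_le_mul_of_nonneg_left (abs_norm_sub_norm_le a b) (by positivity)
  have h2 : (‖a‖ + ‖b‖) * ‖a - b‖ ≤ t * (‖a‖ + ‖b‖) ^ 2 / 2 + ‖a - b‖ ^ 2 / (2 * t) := by
    have : t * (‖a‖ + ‖b‖) ^ 2 / 2 + ‖a - b‖ ^ 2 / (2 * t) - (‖a‖ + ‖b‖) * ‖a - b‖
        = (t * (‖a‖ + ‖b‖) - ‖a - b‖) ^ 2 / (2 * t) := by
      field_simp
      ring
    have h3 : 0 ≤ (t * (‖a‖ + ‖b‖) - ‖a - b‖) ^ 2 / (2 * t) := by positivity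
    linarith
  nlinarith [mul_nonneg ht.le (sq_nonneg (‖a‖ - ‖b‖))]

/-- The weighted AM-GM bound of `abs_norm_sq_sub_le` is additive over steps, and the evolution is
linear, so the errors sum to halting probabilities again. No factor depending on the length of `l`
appears. -/
lemma abs_haltProb_sub_le (M : OneWayQFA A) (S : Finset M.Q) (l : List (TapeSymbol A))
    (φ ψ : EuclideanSpace ℂ M.Q) {t : ℝ} (ht : 0 < t) :
    |M.haltProb S l φ - M.haltProb S l ψ|
      ≤ t * (M.haltProb S l φ + M.haltProb S l ψ) + M.haltProb S l (φ - ψ) / (2 * t) := by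
  induction l generalizing φ ψ with
  | nil => simp [haltProb]
  | cons σ l ih =>
    have h1 := ih (M.proj M.Qnon (M.U σ φ)) (M.proj M.Qnon (M.U σ ψ))
    have h2 := abs_norm_sq_sub_le (M.proj S (M.U σ φ)) (M.proj S (M.U σ ψ)) ht
    simp only [← map_sub] at h1 h2
    simp only [haltProb]
    rw [add_sub_add_comm, add_div]
    refine (abs_add_le _ _).trans ?_
    linarith

/-- Two configurations at distance `δ` have acceptance probabilities that differ by `O(δ)`,
independently of the word that is read. -/
lemma foldl_step_acc_sub_le (M : OneWayQFA A) (l : List (TapeSymbol A))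
    (ψ ψ' : EuclideanSpace ℂ M.Q × ℝ × ℝ) (h : ‖ψ.1‖ ≤ 1) (h' : ‖ψ'.1‖ ≤ 1) {δ : ℝ}
    (hδ : 0 < δ) (hd : dist ψ ψ' ≤ δ) :
    (l.foldl M.step ψ).2.1 - (l.foldl M.step ψ').2.1 ≤ 4 * δ := by
  rw [foldl_step_acc, foldl_step_acc]
  -- The weight `t = δ` gives at most `2 * δ + δ / 2`; the accumulators contribute another `δ`.
  have h1 := (le_abs_self _).trans (M.abs_haltProb_sub_le M.Qacc l ψ.1 ψ'.1 hδ)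
  have hb := M.haltProb_acc_le l ψ.1
  have hb' := M.haltProb_acc_le l ψ'.1
  have hs := M.haltProb_acc_le l (ψ.1 - ψ'.1)
  have hd1 : ‖ψ.1 - ψ'.1‖ ≤ δ := by
    rw [← dist_eq_norm]; exact (le_max_left _ _).trans hd
  have hd2 : dist ψ.2.1 ψ'.2.1 ≤ δ :=
    (le_max_left _ _).trans ((le_max_right _ _).trans hd)
  have hd3 := (le_abs_self _).trans (Real.dist_eq _ _ ▸ hd2)
  have e1 : ‖ψ.1‖ ^ 2 ≤ 1 := pow_le_one₀ (norm_nonneg _) h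
  have e2 : ‖ψ'.1‖ ^ 2 ≤ 1 := pow_le_one₀ (norm_nonneg _) h'
  have e3 : ‖ψ.1 - ψ'.1‖ ^ 2 ≤ δ ^ 2 := pow_le_pow_left₀ (norm_nonneg _) hd1 2
  have e4 : M.haltProb M.Qacc l (ψ.1 - ψ'.1) / (2 * δ) ≤ δ / 2 := by
    rw [div_le_iff₀ (by positivity)]
    nlinarith
  have e5 : δ * (M.haltProb M.Qacc l ψ.1 + M.haltProb M.Qacc l ψ'.1) ≤ δ * 2 :=
    mul_le_mul_of_nonneg_left (by linarith) hδ.le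
  linarith

lemma norm_foldl_step_le_one (M : OneWayQFA A) (l : List (TapeSymbol A)) :
    ‖l.foldl M.step (EuclideanSpace.single M.q₀ 1, 0, 0)‖ ≤ 1 := by
  have h := M.foldl_step_conserve l (EuclideanSpace.single M.q₀ 1, 0, 0)
  have ha := M.foldl_step_acc l (EuclideanSpace.single M.q₀ 1, 0, 0)
  have hr := M.foldl_step_rej l (EuclideanSpace.single M.q₀ 1, 0, 0)
  have ha0 := M.haltProb_nonneg M.Qacc l (EuclideanSpace.single M.q₀ 1)
  have hr0 := M.haltProb_nonneg M.Qrej l (EuclideanSpace.single M.q₀ 1)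
  simp only [PiLp.norm_single, norm_one, one_pow, add_zero, zero_add] at h ha hr
  generalize l.foldl M.step (EuclideanSpace.single M.q₀ 1, 0, 0) = ψ at *
  have h0 := sq_nonneg ‖ψ.1‖
  -- The product carries the sup norm, so each coordinate is bounded separately.
  refine max_le ?_ (max_le ?_ ?_)
  · exact (sq_le_one_iff₀ (norm_nonneg _)).mp (by linarith)
  · exact abs_le.mpr ⟨by linarith, by linarith⟩
  · exact abs_le.mpr ⟨by linarith, by linarith⟩

/-! ### Steps between basis states -/

lemma proj_single (M : OneWayQFA A) (S : Finset M.Q) (q : M.Q) :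
    M.proj S (EuclideanSpace.single q 1) = if q ∈ S then EuclideanSpace.single q 1 else 0 := by
  ext p
  by_cases hp : p = q
  · subst hp
    by_cases h : p ∈ S <;> simp [proj, h]
  · by_cases h : q ∈ S <;> simp [proj, h, hp]

lemma step_single_non (M : OneWayQFA A) {σ : TapeSymbol A} {q q' : M.Q} (a b : ℝ)
    (hU : M.U σ (EuclideanSpace.single q 1) = EuclideanSpace.single q' 1)
    (ha : q' ∉ M.Qacc) (hr : q' ∉ M.Qrej) :
    M.step (EuclideanSpace.single q 1, a, b) σ = (EuclideanSpace.single q' 1, a, b) := by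
  simp [step, hU, proj_single, Qnon, ha, hr]

lemma step_single_acc (M : OneWayQFA A) {σ : TapeSymbol A} {q q' : M.Q} (a b : ℝ)
    (hU : M.U σ (EuclideanSpace.single q 1) = EuclideanSpace.single q' 1)
    (ha : q' ∈ M.Qacc) :
    M.step (EuclideanSpace.single q 1, a, b) σ = (0, a + 1, b) := by
  have hr := Finset.disjoint_left.mp M.disjoint_acc_rej ha
  simp [step, hU, proj_single, Qnon, ha, hr]

lemma step_single_rej (M : OneWayQFA A) {σ : TapeSymbol A} {q q' : M.Q} (a b : ℝ)
    (hU : M.U σ (EuclideanSpace.single q 1) = EuclideanSpace.single q' 1)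
    (hr : q' ∈ M.Qrej) :
    M.step (EuclideanSpace.single q 1, a, b) σ = (0, a, b + 1) := by
  have ha := Finset.disjoint_right.mp M.disjoint_acc_rej hr
  simp [step, hU, proj_single, Qnon, ha, hr]

end OneWayQFA

/-! ### The inclusion -/

/-- Deterministic advice is randomized advice that is concentrated on one string. -/
theorem OneQFA_n_subset_OneQFA_Rn : OneQFA_n ⊆ OneQFA_Rn := by
  classical
  rintro L ⟨Γ, _, hΓ, M, ε, h, h0, h1, hlen, hL⟩
  have : Fintype Γ := Fintype.ofFinite Γ
  let g : ∀ n, Fin n → Γ := fun n i => (h n).get (i.cast (hlen n).symm)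
  have hg : ∀ n, List.ofFn (g n) = h n := fun n =>
    List.ext_getElem (by simp [hlen]) fun i _ _ => by simp [g]
  refine ⟨Γ, inferInstance, hΓ, M, ε,
    ⟨fun n y => if y = g n then 1 else 0, fun n y => by split_ifs <;> simp, fun n => by simp⟩,
    h0, h1, fun x => ?_⟩
  simpa [paccR, prejR, hg] using hL x

/-! ### Palindromes with randomized advice -/

/-- The language of palindromes over the alphabet `ℤ/3ℤ`. -/
def palindromes : LanguageOverAlphabet where
  Alphabet := ZMod 3
  finite := inferInstance
  nonempty := inferInstance
  language := {x | x.reverse = x}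

/-- The permutation of the states of the inner product automaton for each tape symbol. -/
def innerProductPerm : TapeSymbol (ZMod 3 × ZMod 3) → Equiv.Perm (ZMod 3 × Bool)
  | .leftEnd => 1
  | .sym a => (Equiv.addRight (a.1 * a.2)).prodCongr (Equiv.refl _)
  -- Halting states are those with flag `true`, and only the right endmarker flips the flag, so no
  -- run from the initial state halts earlier.
  | .rightEnd => (Equiv.refl _).prodCongr Equiv.boolNot

/-- The reversible automaton that tests whether the inner product of the two tracks vanishes. -/
noncomputable def innerProductQFA : OneWayQFA (ZMod 3 × ZMod 3) where
  Q := ZMod 3 × Bool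
  fintypeQ := inferInstance
  decEqQ := inferInstance
  U σ := LinearIsometryEquiv.piLpCongrLeft 2 ℂ ℂ (innerProductPerm σ)
  q₀ := (0, false)
  Qacc := {q | q.1 = 0 ∧ q.2 = true}
  Qrej := {q | q.1 ≠ 0 ∧ q.2 = true}
  disjoint_acc_rej := by decide

lemma innerProductQFA_U_single (σ : TapeSymbol (ZMod 3 × ZMod 3)) (q : ZMod 3 × Bool) :
    innerProductQFA.U σ (EuclideanSpace.single (ι := innerProductQFA.Q) q 1)
      = EuclideanSpace.single (ι := innerProductQFA.Q) (innerProductPerm σ q) 1 :=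
  LinearIsometryEquiv.piLpCongrLeft_single (p := 2) (𝕜 := ℂ) (E := ℂ) (innerProductPerm σ) q 1

lemma mem_innerProductQFA_Qacc (q : ZMod 3 × Bool) :
    q ∈ innerProductQFA.Qacc ↔ q.1 = 0 ∧ q.2 = true :=
  Finset.mem_filter_univ q

lemma mem_innerProductQFA_Qrej (q : ZMod 3 × Bool) :
    q ∈ innerProductQFA.Qrej ↔ q.1 ≠ 0 ∧ q.2 = true :=
  Finset.mem_filter_univ q

lemma innerProductQFA_foldl_sym (x : List (ZMod 3 × ZMod 3)) (s : ZMod 3) :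
    (x.map TapeSymbol.sym).foldl innerProductQFA.step
        (EuclideanSpace.single (ι := innerProductQFA.Q) (s, false) 1, 0, 0)
      = (EuclideanSpace.single (ι := innerProductQFA.Q)
          (s + (x.map fun a => a.1 * a.2).sum, false) 1, 0, 0) := by
  induction x generalizing s with
  | nil => simp
  | cons a x ih =>
    rw [List.map_cons, List.foldl_cons,
      innerProductQFA.step_single_non 0 0 (innerProductQFA_U_single _ _)
        (by exact fun h => Bool.false_ne_true ((mem_innerProductQFA_Qacc _).mp h).2)
        (by exact fun h => Bool.false_ne_true ((mem_innerProductQFA_Qrej _).mp h).2)]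
    refine (ih (s + a.1 * a.2)).trans ?_
    simp [add_assoc]

lemma innerProductQFA_run (x : List (ZMod 3 × ZMod 3)) :
    (innerProductQFA.run x).2 =
      if (x.map fun a => a.1 * a.2).sum = 0 then (1, 0) else (0, 1) := by
  have h0 : innerProductQFA.step
      (EuclideanSpace.single (ι := innerProductQFA.Q) (0, false) 1, 0, 0) TapeSymbol.leftEnd
      = (EuclideanSpace.single (ι := innerProductQFA.Q) (0, false) 1, 0, 0) :=
    innerProductQFA.step_single_non 0 0 (innerProductQFA_U_single _ _)
      (by exact fun h => Bool.false_ne_true ((mem_innerProductQFA_Qacc _).mp h).2)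
      (by exact fun h => Bool.false_ne_true ((mem_innerProductQFA_Qrej _).mp h).2)
  have h1 : innerProductQFA.run x = innerProductQFA.step
      (EuclideanSpace.single (ι := innerProductQFA.Q)
          ((x.map fun a => a.1 * a.2).sum, false) 1, 0, 0) TapeSymbol.rightEnd := by
    rw [OneWayQFA.run, tape, List.foldl_cons, List.foldl_append]
    erw [h0, innerProductQFA_foldl_sym, zero_add]
    rfl
  rw [h1]
  split_ifs with h
  · rw [innerProductQFA.step_single_acc 0 0 (innerProductQFA_U_single _ _)
      (by exact (mem_innerProductQFA_Qacc _).mpr ⟨h, rfl⟩)]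
    simp
  · rw [innerProductQFA.step_single_rej 0 0 (innerProductQFA_U_single _ _)
      (by exact (mem_innerProductQFA_Qrej _).mpr ⟨h, rfl⟩)]
    simp

lemma innerProductQFA_pacc (x : List (ZMod 3 × ZMod 3)) :
    innerProductQFA.pacc x = if (x.map fun a => a.1 * a.2).sum = 0 then 1 else 0 := by
  rw [OneWayQFA.pacc, innerProductQFA_run]; split_ifs <;> rfl

lemma innerProductQFA_prej (x : List (ZMod 3 × ZMod 3)) :
    innerProductQFA.prej x = if (x.map fun a => a.1 * a.2).sum = 0 then 0 else 1 := by
  rw [OneWayQFA.prej, innerProductQFA_run]; split_ifs <;> rfl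

lemma sum_track_ofFn {R : Type} [Semiring R] (x : List R) (y : Fin x.length → R) :
    ((track x (List.ofFn y)).map fun a => a.1 * a.2).sum = ∑ i, x.get i * y i := by
  have : (track x (List.ofFn y)).map (fun a => a.1 * a.2)
      = List.ofFn fun i : Fin x.length => x.get i * y i :=
    List.ext_getElem (by simp [track]) fun i _ _ => by simp [track]
  rw [this, List.sum_ofFn]

/-- The advice `r - r ∘ rev`, where `r` is drawn uniformly. -/
noncomputable def antisymmetricEnsemble : AdviceEnsemble (ZMod 3) where
  D n y := ∑ r : Fin n → ZMod 3, if y = r - r ∘ Fin.rev then ((3 : ℝ) ^ n)⁻¹ else 0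
  nonneg n y := Finset.sum_nonneg fun r _ => by split_ifs <;> positivity
  sum_eq_one n := by
    rw [Finset.sum_comm]
    simp

lemma sum_antisymmetricEnsemble_mul (n : ℕ) (f : (Fin n → ZMod 3) → ℝ) :
    ∑ y, antisymmetricEnsemble.D n y * f y
      = ((3 : ℝ) ^ n)⁻¹ * ∑ r : Fin n → ZMod 3, f (r - r ∘ Fin.rev) := by
  simp only [antisymmetricEnsemble, Finset.sum_mul, Finset.mul_sum]
  rw [Finset.sum_comm]
  simp [ite_mul]

/-- Reversal is self-adjoint for the dot product. -/
lemma sum_mul_sub_rev {R : Type} [CommRing R] {n : ℕ} (c r : Fin n → R) :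
    ∑ i, c i * (r - r ∘ Fin.rev) i = ∑ i, (c i - c i.rev) * r i := by
  have h : ∑ i, c i * r i.rev = ∑ i, c i.rev * r i :=
    (Equiv.sum_comp Fin.revPerm fun i => c i * r i.rev).symm.trans (by simp)
  simp only [Pi.sub_apply, Function.comp_apply, mul_sub, sub_mul, Finset.sum_sub_distrib, h]

/-- A nonzero linear form over `ℤ/3ℤ` is nonzero on two thirds of all vectors. -/
lemma sum_linearForm_ne_zero {n : ℕ} (c : Fin n → ZMod 3) (j : Fin n) (hj : c j ≠ 0) :
    ∑ r : Fin n → ZMod 3, (if ∑ i, c i * r i = 0 then (0 : ℝ) else 1) = 2 / 3 * 3 ^ n := by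
  set F : (Fin n → ZMod 3) → ℝ := fun r => if ∑ i, c i * r i = 0 then (0 : ℝ) else 1 with hF
  -- Average over translates along coordinate `j`: the total is unchanged, while for fixed `r` the
  -- form takes each value of `ZMod 3` exactly once.
  have h1 : ∀ t : ZMod 3, ∑ r, F (r + Pi.single (M := fun _ => ZMod 3) j t) = ∑ r, F r := fun t =>
    Fintype.sum_equiv (Equiv.addRight (Pi.single (M := fun _ => ZMod 3) j t)) _ _ fun _ => by
      rw [Equiv.coe_addRight]
  have h2 : ∀ r, ∑ t : ZMod 3, F (r + Pi.single (M := fun _ => ZMod 3) j t) = 2 := by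
    intro r
    have : ∀ t, F (r + Pi.single (M := fun _ => ZMod 3) j t) = if ∑ i, c i * r i + c j * t = 0 then (0 : ℝ) else 1 := by
      intro t
      simp [hF, mul_add, Finset.sum_add_distrib, Pi.single_apply]
    simp only [this]
    generalize ∑ i, c i * r i = a
    generalize c j = b at hj
    have hcount : ∀ a b : ZMod 3, b ≠ 0 →
        ∑ t : ZMod 3, (if a + b * t = 0 then 0 else 1) = 2 := by decide
    have hcast := congrArg (Nat.cast (R := ℝ)) (hcount a b hj)
    rw [Nat.cast_sum] at hcast
    simpa only [Nat.cast_ite, Nat.cast_zero, Nat.cast_one, Nat.cast_ofNat] using hcast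
  have h3 : ∑ t : ZMod 3, ∑ r, F (r + Pi.single (M := fun _ => ZMod 3) j t) = 2 * 3 ^ n := by
    rw [Finset.sum_comm, Finset.sum_congr rfl fun r _ => h2 r]
    simp [mul_comm]
  simp only [h1, Finset.sum_const, Finset.card_univ, ZMod.card, nsmul_eq_mul, Nat.cast_ofNat] at h3
  change ∑ r, F r = _
  linarith

lemma reverse_eq_self_iff {α : Type} (x : List α) :
    x.reverse = x ↔ ∀ i : Fin x.length, x.get i = x.get i.rev := by
  constructor
  · intro h i
    have : x.reverse[(i : ℕ)]'(by simp) = x[(i : ℕ)] := by simp only [h]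
    rw [List.getElem_reverse] at this
    rw [List.get_eq_getElem, List.get_eq_getElem, ← this]
    congr 1
    simp only [Fin.val_rev]
    omega
  · intro h
    refine List.ext_getElem (by simp) fun i h1 h2 => ?_
    have := h ⟨i, h2⟩
    rw [List.get_eq_getElem, List.get_eq_getElem] at this
    rw [List.getElem_reverse]
    simp only at this
    rw [this]
    congr 1
    simp only [Fin.val_rev]
    omega

theorem palindromes_mem_OneQFA_Rn : palindromes ∈ OneQFA_Rn := by
  refine ⟨ZMod 3, inferInstance, inferInstance, innerProductQFA, 1 / 3, antisymmetricEnsemble,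
    by norm_num, by norm_num, fun (x : List (ZMod 3)) => ?_⟩
  have hpow : (3 : ℝ) ^ x.length ≠ 0 := by positivity
  have hsum : ∀ r : Fin x.length → ZMod 3,
      ((track x (List.ofFn (r - r ∘ Fin.rev))).map fun a => a.1 * a.2).sum
        = ∑ i, (x.get i - x.get i.rev) * r i := fun r => by
    rw [sum_track_ofFn, sum_mul_sub_rev]
  constructor
  · intro hx
    have hx' := (reverse_eq_self_iff x).mp hx
    have : paccR innerProductQFA antisymmetricEnsemble x = 1 := by
      rw [paccR, sum_antisymmetricEnsemble_mul]
      simp only [innerProductQFA_pacc, hsum]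
      have hz : ∀ r : Fin x.length → ZMod 3,
          ∑ i, (x.get i - x.get i.rev) * r i = 0 := fun r =>
        Finset.sum_eq_zero fun i _ => by rw [hx' i, sub_self, zero_mul]
      simp only [hz, if_true]
      simp [hpow]
    change _ ≤ paccR innerProductQFA antisymmetricEnsemble x
    rw [this]; norm_num
  · intro hx
    have hx' : ¬ ∀ i : Fin x.length, x.get i = x.get i.rev :=
      fun h => hx ((reverse_eq_self_iff x).mpr h)
    push Not at hx'
    obtain ⟨j, hj⟩ := hx'
    have : prejR innerProductQFA antisymmetricEnsemble x = 2 / 3 := by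
      rw [prejR, sum_antisymmetricEnsemble_mul]
      simp only [innerProductQFA_prej, hsum]
      rw [sum_linearForm_ne_zero (fun i => x.get i - x.get i.rev) j (sub_ne_zero.mpr hj)]
      field_simp
    change _ ≤ prejR innerProductQFA antisymmetricEnsemble x
    rw [this]; norm_num

/-! ### Palindromes defeat deterministic advice -/

/-- A totally bounded set has no arbitrarily large finite `δ`-separated families. -/
lemma exists_pair_dist_le {X : Type*} [PseudoMetricSpace X] {s : Set X} (hs : TotallyBounded s)
    {δ : ℝ} (hδ : 0 < δ) :
    ∃ N : ℕ, ∀ (ι : Type) [Fintype ι] (f : ι → X), (∀ i, f i ∈ s) → N < Fintype.card ι →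
      ∃ i j, i ≠ j ∧ dist (f i) (f j) ≤ δ := by
  classical
  obtain ⟨t, ht, hst⟩ := Metric.totallyBounded_iff.mp hs (δ / 2) (half_pos hδ)
  have : Fintype t := ht.fintype
  refine ⟨Fintype.card t, fun ι _ f hf hcard => ?_⟩
  have hc : ∀ i, ∃ c : t, dist (f i) c < δ / 2 := fun i => by
    simpa using hst (hf i)
  choose c hc using hc
  obtain ⟨i, j, hij, hcij⟩ := Fintype.exists_ne_map_eq_of_card_lt c hcard
  refine ⟨i, j, hij, ?_⟩
  have h1 := hc i
  have h2 := hc j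
  rw [← hcij] at h2
  linarith [dist_triangle_right (f i) (f j) (c i)]

theorem palindromes_notMem_OneQFA_n : palindromes ∉ OneQFA_n := by
  rintro ⟨Γ, _, _, M, ε, h, -, hε, hlen, hL⟩
  change OneWayQFA (ZMod 3 × Γ) at M
  -- Chosen so that `4 * δ` is half of the forced gap `1 - 2 * ε`.
  have hδ : 0 < (1 - 2 * ε) / 8 := by linarith
  -- `N` also serves as the half-length: there are `3 ^ N > N` half-words.
  obtain ⟨N, hN⟩ := exists_pair_dist_le
    (ProperSpace.isCompact_closedBall (0 : EuclideanSpace ℂ M.Q × ℝ × ℝ) 1).totallyBounded hδ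
  let conf : (Fin N → ZMod 3) → EuclideanSpace ℂ M.Q × ℝ × ℝ := fun u =>
    (TapeSymbol.leftEnd ::
      (track (List.ofFn u) ((h (N + N)).take N)).map TapeSymbol.sym).foldl M.step
        (EuclideanSpace.single M.q₀ 1, 0, 0)
  have hconf : ∀ u, ‖conf u‖ ≤ 1 := fun u => M.norm_foldl_step_le_one _
  obtain ⟨u, u', hne, hd⟩ := hN (Fin N → ZMod 3) conf
    (fun u => mem_closedBall_zero_iff.mpr (hconf u)) (by simpa using Nat.lt_pow_self (by norm_num))
  -- The advice depends only on the length `N + N`, so both words share this suffix.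
  let rest := (track (List.ofFn u).reverse ((h (N + N)).drop N)).map TapeSymbol.sym
    ++ [TapeSymbol.rightEnd]
  have hpacc : ∀ w : Fin N → ZMod 3,
      M.pacc (track (List.ofFn w ++ (List.ofFn u).reverse) (h (N + N)))
        = (rest.foldl M.step (conf w)).2.1 := by
    intro w
    have ht : track (List.ofFn w ++ (List.ofFn u).reverse) (h (N + N))
        = track (List.ofFn w) ((h (N + N)).take N)
          ++ track (List.ofFn u).reverse ((h (N + N)).drop N) := by
      conv_lhs => rw [← List.take_append_drop N (h (N + N))]
      exact List.zip_append (by simp [hlen])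
    simp only [conf, rest, OneWayQFA.pacc, OneWayQFA.run, tape, ht, ← List.foldl_append,
      List.map_append, List.cons_append, List.append_assoc]
  have hlength : ∀ w : Fin N → ZMod 3,
      (List.ofFn w ++ (List.ofFn u).reverse).length = N + N := fun w => by simp
  have hacc := (hL (List.ofFn u ++ (List.ofFn u).reverse)).1
    (show List.reverse _ = _ by simp)
  have hrej := (hL (List.ofFn u' ++ (List.ofFn u).reverse)).2 fun hmem => by
    have hmem : (List.ofFn u' ++ (List.ofFn u).reverse).reverse
      = List.ofFn u' ++ (List.ofFn u).reverse := hmem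
    rw [List.reverse_append, List.reverse_reverse] at hmem
    exact hne (List.ofFn_injective (List.append_inj_left hmem (by simp)))
  have hsum := M.pacc_add_prej_le_one
    (track (List.ofFn u' ++ (List.ofFn u).reverse) (h (N + N)))
  have hclose := M.foldl_step_acc_sub_le rest (conf u) (conf u')
    ((le_max_left _ _).trans (hconf u)) ((le_max_left _ _).trans (hconf u')) hδ hd
  rw [← hpacc, ← hpacc] at hclose
  have hl := hlength u
  have hl' := hlength u'
  erw [hl] at hacc
  erw [hl'] at hrej
  have hacc : 1 - ε ≤ M.pacc (track (List.ofFn u ++ (List.ofFn u).reverse) (h (N + N))) := hacc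
  have hrej : 1 - ε ≤ M.prej (track (List.ofFn u' ++ (List.ofFn u).reverse) (h (N + N))) := hrej
  linarith

end AdvisedQFA

theorem mainTheorem7 :
    AdvisedQFA.OneQFA_n ⊆ AdvisedQFA.OneQFA_Rn ∧
      AdvisedQFA.OneQFA_n ≠ AdvisedQFA.OneQFA_Rn :=
  ⟨AdvisedQFA.OneQFA_n_subset_OneQFA_Rn, fun h =>
    AdvisedQFA.palindromes_notMem_OneQFA_n (h ▸ AdvisedQFA.palindromes_mem_OneQFA_Rn)⟩
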